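/- Let $\mathbb K$ be a field of characteristic $0$. A 3-Lie algebra is a $\mathbb K$-vector space $\mathfrak g$ with an alternating trilinear bracket such that $[x_1,x_2,[x_3,x_4,x_5]]=[[x_1,x_2,x_3],x_4,x_5]+[x_3,[x_1,x_2,x_4],x_5]+[x_3,x_4,[x_1,x_2,x_5]]$. An action of a 3-Lie algebra $\mathfrak g$ on a 3-Lie algebra $\mathfrak h$ is a linear map $\rho:\wedge^2\mathfrak g\to\mathfrak{gl}(\mathfrak h)$ with $$\rho(x_1,x_2)\rho(x_3,x_4)=\rho([x_1,x_2,x_3],x_4)+\rho(x_3,[x_1,x_2,x_4])+\rho(x_3,x_4)\rho(x_1,x_2),$$ $$\rho(x_1,[x_2,x_3,x_4])=\rho(x_3,x_4)\rho(x_1,x_2)-\rho(x_2,x_4)\rho(x_1,x_3)+\rho(x_2,x_3)\rho(x_1,x_4),$$ such that $[\rho(x,y)u,v,w]_{\mathfrak h}=0$ and $\rho(x,y)[u,v,w]_{\mathfrak h}=0$ for all $x,y\in\mathfrak g$, $u,v,w\in\mathfrak h$. For $\lambda\in\mathbb K$, a linear map $T:\mathfrak h\to\mathfrak g$ is a relative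 Rota-Baxter operator of weight $\lambda$ if $[Tu,Tv,Tw]_{\mathfrak g}=T([u,v,w]_T)$ for all $u,v,w\in\mathfrak h$, where $$[u,v,w]_T=\rho(Tu,Tv)w+\rho(Tv,Tw)u+\rho(Tw,Tu)v+\lambda[u,v,w]_{\mathfrak h}$$ is the descendent 3-Lie bracket on $\mathfrak h$. Put $\varrho(u,v)x=[Tu,Tv,x]_{\mathfrak g}-T(\rho(x,Tu)v+\rho(Tv,x)u)$ for $u,v\in\mathfrak h$, $x\in\mathfrak g$. For vector spaces $V,W$ let $C^m(V,W)=\mathrm{Hom}\big((\wedge^2V)^{\otimes m}\wedge V,W\big)$, $m\ge0$: the maps $f(\mathfrak X_1,\dots,\mathfrak X_m,z)$ with $\mathfrak X_i=x_i\wedge y_i\in\wedge^2V$ and $z\in V$ that are linear in every argument and alternating in the last three vectors $x_m,y_m,z$. For $n\ge1$, the coboundary operator $\mathrm d_T:C^{n-1}(\mathfrak h,\mathfrak g)\to C^n(\mathfrak h,\mathfrak g)$ of $(\mathfrak h,[\cdot,\cdot,\cdot]_T)$ with coefficients in $(\mathfrak g;\varrho)$ is, with $\mathfrak U_i=u_i\wedge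 v_i$, $$\begin{aligned}(\mathrm d_Tf)(\mathfrak U_1,\dots,\mathfrak U_n,u_{n+1})={}&\sum_{1\le j<k\le n}(-1)^jf(\mathfrak U_1,\dots,\widehat{\mathfrak U_j},\dots,\mathfrak U_{k-1},[u_j,v_j,u_k]_T\wedge v_k+u_k\wedge[u_j,v_j,v_k]_T,\mathfrak U_{k+1},\dots,\mathfrak U_n,u_{n+1})\\&+\sum_{j=1}^n(-1)^jf(\mathfrak U_1,\dots,\widehat{\mathfrak U_j},\dots,\mathfrak U_n,[u_j,v_j,u_{n+1}]_T)\\&+\sum_{j=1}^n(-1)^{j+1}\varrho(u_j,v_j)f(\mathfrak U_1,\dots,\widehat{\mathfrak U_j},\dots,\mathfrak U_n,u_{n+1})\\&+(-1)^{n+1}\big(\varrho(v_n,u_{n+1})f(\mathfrak U_1,\dots,\mathfrak U_{n-1},u_n)+\varrho(u_{n+1},u_n)f(\mathfrak U_1,\dots,\mathfrak U_{n-1},v_n)\big).\end{aligned}$$ On $C^*(V,V)$ let $[P,Q]=P\circ Q-(-1)^{pq}Q\circ P$ for $P\in C^p(V,V)$, $Q\in C^q(V,V)$, where $$\begin{aligned}(P\circ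 Q)(\mathfrak X_1,\dots,\mathfrak X_{p+q},z)={}&\sum_{k=1}^p(-1)^{(k-1)q}\sum_{\sigma\in\mathbb S(k-1,q)}(-1)^\sigma P\big(\mathfrak X_{\sigma(1)},\dots,\mathfrak X_{\sigma(k-1)},\,Q_{k,\sigma}(x_{k+q})\wedge y_{k+q}+x_{k+q}\wedge Q_{k,\sigma}(y_{k+q}),\,\mathfrak X_{k+q+1},\dots,\mathfrak X_{p+q},z\big)\\&+\sum_{\sigma\in\mathbb S(p,q)}(-1)^{pq}(-1)^\sigma P\big(\mathfrak X_{\sigma(1)},\dots,\mathfrak X_{\sigma(p)},Q(\mathfrak X_{\sigma(p+1)},\dots,\mathfrak X_{\sigma(p+q)},z)\big),\end{aligned}$$ $\mathbb S(a,b)$ denotes the $(a,b)$-shuffles, and $Q_{k,\sigma}(w)=Q(\mathfrak X_{\sigma(k)},\dots,\mathfrak X_{\sigma(k+q-1)},w)$. Let $\Delta\in C^1(\mathfrak g\oplus\mathfrak h,\mathfrak g\oplus\mathfrak h)$ be $$\Delta(x+u,y+v,z+w)=[x,y,z]_{\mathfrak g}+\rho(x,y)w+\rho(y,z)u+\rho(z,x)v+\lambda[u,v,w]_{\mathfrak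 h},$$ let $\mathcal P$ be the projection of $C^*(\mathfrak g\oplus\mathfrak h,\mathfrak g\oplus\mathfrak h)$ onto $C^*(\mathfrak h,\mathfrak g)$ (restrict the arguments to $\mathfrak h$ and take the $\mathfrak g$-component of the value), and put $$l_1(P)=\mathcal P[\Delta,P],\qquad l_3(P,Q,R)=\mathcal P[[[\Delta,P],Q],R],\qquad l_1^T(P)=l_1(P)+\tfrac12\,l_3(T,T,P)$$ for $P,Q,R\in C^*(\mathfrak h,\mathfrak g)$, extended by zero to $\mathfrak g\oplus\mathfrak h$ and regarded as having values in $\mathfrak g\oplus\mathfrak h$; thus $l_1^T$ is the differential of the $L_\infty$-algebra $(C^*(\mathfrak h,\mathfrak g),l_1,l_3)$ twisted by its Maurer-Cartan element $T$. **Theorem.** Let $T:\mathfrak h\to\mathfrak g$ be a relative Rota-Baxter operator of weight $\lambda$ with respect to an action $\rho$ of $\mathfrak g$ on $\mathfrak h$. Then for every $n\ge1$ and every $n$-cochain $f\in C^{n-1}(\mathfrak h,\mathfrak g)$, $$\mathrm d_Tf=(-1)^{n-1}\,l_1^Tf .$$ -/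

import Mathlib

namespace ThreeLie

open Function

/-! ### Auxiliary facts on alternating maps in two and three arguments -/

section

variable {K V W : Type*} [Field K] [AddCommGroup V] [Module K V] [AddCommGroup W] [Module K W]

theorem alt2_linear_fst (f : V [⋀^Fin 2]→ₗ[K] W) (b : V) :
    IsLinearMap K (fun x => f ![x, b]) := by
  have e : ∀ t : V, update ![0, b] 0 t = ![t, b] := by
    intro t; ext i; fin_cases i <;> rfl
  constructor
  · intro x y
    simpa only [e] using f.map_update_add ![0, b] 0 x y
  · intro c x
    simpa only [e] using f.map_update_smul ![0, b] 0 c x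

theorem alt2_linear_snd (f : V [⋀^Fin 2]→ₗ[K] W) (a : V) :
    IsLinearMap K (fun x => f ![a, x]) := by
  have e : ∀ t : V, update ![a, 0] 1 t = ![a, t] := by
    intro t; ext i; fin_cases i <;> rfl
  constructor
  · intro x y
    simpa only [e] using f.map_update_add ![a, 0] 1 x y
  · intro c x
    simpa only [e] using f.map_update_smul ![a, 0] 1 c x

theorem alt3_linear_fst (f : V [⋀^Fin 3]→ₗ[K] W) (b d : V) :
    IsLinearMap K (fun x => f ![x, b, d]) := by
  have e : ∀ t : V, update ![0, b, d] 0 t = ![t, b, d] := by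
    intro t; ext i; fin_cases i <;> rfl
  constructor
  · intro x y
    simpa only [e] using f.map_update_add ![0, b, d] 0 x y
  · intro c x
    simpa only [e] using f.map_update_smul ![0, b, d] 0 c x

theorem alt3_linear_snd (f : V [⋀^Fin 3]→ₗ[K] W) (a d : V) :
    IsLinearMap K (fun x => f ![a, x, d]) := by
  have e : ∀ t : V, update ![a, 0, d] 1 t = ![a, t, d] := by
    intro t; ext i; fin_cases i <;> rfl
  constructor
  · intro x y
    simpa only [e] using f.map_update_add ![a, 0, d] 1 x y
  · intro c x
    simpa only [e] using f.map_update_smul ![a, 0, d] 1 c x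

theorem alt3_linear_trd (f : V [⋀^Fin 3]→ₗ[K] W) (a b : V) :
    IsLinearMap K (fun x => f ![a, b, x]) := by
  have e : ∀ t : V, update ![a, b, 0] 2 t = ![a, b, t] := by
    intro t; ext i; fin_cases i <;> rfl
  constructor
  · intro x y
    simpa only [e] using f.map_update_add ![a, b, 0] 2 x y
  · intro c x
    simpa only [e] using f.map_update_smul ![a, b, 0] 2 c x

theorem alt2_self (f : V [⋀^Fin 2]→ₗ[K] W) (a : V) : f ![a, a] = 0 :=
  f.map_eq_zero_of_eq (i := 0) (j := 1) _ (by simp) (by simp)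

theorem alt2_swap (f : V [⋀^Fin 2]→ₗ[K] W) (a b : V) : f ![a, b] = -f ![b, a] := by
  rw [← f.map_swap ![b, a] (i := 0) (j := 1) (by simp)]
  congr 1
  ext i
  fin_cases i <;> simp

theorem alt3_self_fst (f : V [⋀^Fin 3]→ₗ[K] W) (a b : V) : f ![a, a, b] = 0 :=
  f.map_eq_zero_of_eq (i := 0) (j := 1) _ (by simp) (by simp)

theorem alt3_self_snd (f : V [⋀^Fin 3]→ₗ[K] W) (a b : V) : f ![b, a, a] = 0 :=
  f.map_eq_zero_of_eq (i := 1) (j := 2) _ (by simp) (by simp)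

theorem linear_add {φ ψ : V → W} (h₁ : IsLinearMap K φ) (h₂ : IsLinearMap K ψ) :
    IsLinearMap K (fun x => φ x + ψ x) :=
  (h₁.mk' φ + h₂.mk' ψ).isLinear

theorem linear_smul (c : K) {φ : V → W} (h₁ : IsLinearMap K φ) :
    IsLinearMap K (fun x => c • φ x) :=
  (c • h₁.mk' φ).isLinear

theorem linear_sum {ι : Type*} (s : Finset ι) {φ : ι → V → W}
    (h₁ : ∀ i ∈ s, IsLinearMap K (φ i)) : IsLinearMap K (fun x => ∑ i ∈ s, φ i x) where
  map_add x y := by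
    rw [← Finset.sum_add_distrib]
    exact Finset.sum_congr rfl fun i hi => (h₁ i hi).map_add x y
  map_smul c x := by
    rw [Finset.smul_sum]
    exact Finset.sum_congr rfl fun i hi => (h₁ i hi).map_smul c x

theorem linear_comp {U : Type*} [AddCommGroup U] [Module K U] {ψ : V → W} {φ : U → V}
    (h₁ : IsLinearMap K ψ) (h₂ : IsLinearMap K φ) : IsLinearMap K (fun x => ψ (φ x)) :=
  ((h₁.mk' ψ).comp (h₂.mk' φ)).isLinear

theorem linear_apply {U : Type*} [AddCommGroup U] [Module K U] {φ : U → Module.End K W}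
    (h₁ : IsLinearMap K φ) (w : W) : IsLinearMap K (fun x => φ x w) where
  map_add x y := by rw [h₁.map_add, LinearMap.add_apply]
  map_smul c x := by rw [h₁.map_smul, LinearMap.smul_apply]

end

/-! ### 3-Lie algebras, representations, actions, relative Rota-Baxter operators -/

/-- A 3-Lie algebra structure on the vector space `V`: an alternating trilinear bracket which
satisfies the Fundamental Identity. -/
structure ThreeLieAlgebra (K V : Type*) [Field K] [AddCommGroup V] [Module K V] where
  bracket : V [⋀^Fin 3]→ₗ[K] V
  fundamental : ∀ x₁ x₂ x₃ x₄ x₅ : V,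
    bracket ![x₁, x₂, bracket ![x₃, x₄, x₅]] =
      bracket ![bracket ![x₁, x₂, x₃], x₄, x₅] + bracket ![x₃, bracket ![x₁, x₂, x₄], x₅] +
        bracket ![x₃, x₄, bracket ![x₁, x₂, x₅]]

/-- The center of a 3-Lie algebra. -/
def ThreeLieAlgebra.center {K V : Type*} [Field K] [AddCommGroup V] [Module K V]
    (A : ThreeLieAlgebra K V) : Set V :=
  {x | ∀ y z : V, A.bracket ![x, y, z] = 0}

/-- A representation `ρ : ⋀² 𝔤 → 𝔤𝔩(V)` of the 3-Lie algebra `A` on the vector space `V`. -/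
structure Representation {K g : Type*} [Field K] [AddCommGroup g] [Module K g]
    (A : ThreeLieAlgebra K g) (V : Type*) [AddCommGroup V] [Module K V] where
  rho : g [⋀^Fin 2]→ₗ[K] Module.End K V
  rho_comp : ∀ x₁ x₂ x₃ x₄ : g,
    rho ![x₁, x₂] * rho ![x₃, x₄] =
      rho ![A.bracket ![x₁, x₂, x₃], x₄] + rho ![x₃, A.bracket ![x₁, x₂, x₄]] +
        rho ![x₃, x₄] * rho ![x₁, x₂]
  rho_bracket : ∀ x₁ x₂ x₃ x₄ : g,
    rho ![x₁, A.bracket ![x₂, x₃, x₄]] =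
      rho ![x₃, x₄] * rho ![x₁, x₂] - rho ![x₂, x₄] * rho ![x₁, x₃] +
        rho ![x₂, x₃] * rho ![x₁, x₄]

/-- An action of the 3-Lie algebra `A` (on `g`) on the 3-Lie algebra `B` (on `h`). -/
structure Action {K g h : Type*} [Field K] [AddCommGroup g] [Module K g]
    [AddCommGroup h] [Module K h] (A : ThreeLieAlgebra K g) (B : ThreeLieAlgebra K h)
    extends Representation A h where
  rho_mem_center : ∀ (x y : g) (u : h), rho ![x, y] u ∈ B.center
  rho_apply_bracket : ∀ (x y : g) (u v w : h), rho ![x, y] (B.bracket ![u, v, w]) = 0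

section

variable {K g h : Type*} [Field K] [AddCommGroup g] [Module K g] [AddCommGroup h] [Module K h]
  {A : ThreeLieAlgebra K g} {B : ThreeLieAlgebra K h}

/-- `T : h → g` is a relative Rota-Baxter operator of weight `lam` with respect to the
action `R`. -/
def IsRelativeRotaBaxter (R : Action A B) (lam : K) (T : h →ₗ[K] g) : Prop :=
  ∀ u v w : h, A.bracket ![T u, T v, T w] =
    T (R.rho ![T u, T v] w + R.rho ![T v, T w] u + R.rho ![T w, T u] v +
      lam • B.bracket ![u, v, w])

/-- The descendent bracket on `h`:
`[u,v,w]_T = ρ(Tu,Tv)w + ρ(Tv,Tw)u + ρ(Tw,Tu)v + λ[u,v,w]`. -/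
def descendentBracket (R : Action A B) (lam : K) (T : h →ₗ[K] g) : h [⋀^Fin 3]→ₗ[K] h where
  toFun v := R.rho ![T (v 0), T (v 1)] (v 2) + R.rho ![T (v 1), T (v 2)] (v 0) +
    R.rho ![T (v 2), T (v 0)] (v 1) + lam • B.bracket v
  map_update_add' := by
    intro inst v i x y
    obtain rfl : inst = instDecidableEqFin 3 := Subsingleton.elim _ _
    rw [B.bracket.map_update_add]
    fin_cases i <;>
      simp [update, (alt2_linear_fst R.rho _).map_add, (alt2_linear_snd R.rho _).map_add] <;>
      abel
  map_update_smul' := by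
    intro inst v i c x
    obtain rfl : inst = instDecidableEqFin 3 := Subsingleton.elim _ _
    rw [B.bracket.map_update_smul]
    fin_cases i <;>
      simp [update, (alt2_linear_fst R.rho _).map_smul, (alt2_linear_snd R.rho _).map_smul,
        smul_comm lam c]
  map_eq_zero_of_eq' := by
    intro v i j hv hij
    rw [B.bracket.map_eq_zero_of_eq v hv hij]
    have h1 := alt2_swap R.rho (T (v 1)) (T (v 2))
    have h2 := alt2_swap R.rho (T (v 0)) (T (v 2))
    have h3 := alt2_swap R.rho (T (v 0)) (T (v 1))
    fin_cases i <;> fin_cases j <;> simp_all [alt2_self]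

/-- The map `ϱ : ⋀² h → 𝔤𝔩(g)`, `ϱ(u,v)x = [Tu,Tv,x] - T(ρ(x,Tu)v + ρ(Tv,x)u)`. -/
def inducedRho (R : Action A B) (T : h →ₗ[K] g) : h [⋀^Fin 2]→ₗ[K] Module.End K g where
  toFun v :=
    { toFun := fun x => A.bracket ![T (v 0), T (v 1), x] -
        T (R.rho ![x, T (v 0)] (v 1) + R.rho ![T (v 1), x] (v 0))
      map_add' := by
        intro x y
        simp only [(alt3_linear_trd A.bracket _ _).map_add, (alt2_linear_fst R.rho _).map_add,
          (alt2_linear_snd R.rho _).map_add, LinearMap.add_apply, map_add]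
        abel
      map_smul' := by
        intro c x
        simp only [(alt3_linear_trd A.bracket _ _).map_smul, (alt2_linear_fst R.rho _).map_smul,
          (alt2_linear_snd R.rho _).map_smul, LinearMap.smul_apply, map_add, map_smul, smul_add,
          smul_sub, RingHom.id_apply] }
  map_update_add' := by
    intro inst v i x y
    obtain rfl : inst = instDecidableEqFin 2 := Subsingleton.elim _ _
    ext z
    fin_cases i <;>
      simp [update, (alt2_linear_fst R.rho _).map_add, (alt2_linear_snd R.rho _).map_add,
        (alt3_linear_fst A.bracket _ _).map_add, (alt3_linear_snd A.bracket _ _).map_add] <;>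
      abel
  map_update_smul' := by
    intro inst v i c x
    obtain rfl : inst = instDecidableEqFin 2 := Subsingleton.elim _ _
    ext z
    fin_cases i <;>
      simp [update, (alt2_linear_fst R.rho _).map_smul, (alt2_linear_snd R.rho _).map_smul,
        (alt3_linear_fst A.bracket _ _).map_smul, (alt3_linear_snd A.bracket _ _).map_smul,
        smul_sub]
  map_eq_zero_of_eq' := by
    intro v i j hv hij
    have hv' : v 0 = v 1 := by
      fin_cases i <;> fin_cases j <;> simp_all
    ext z
    simp [hv', alt3_self_fst, alt2_swap R.rho z (T (v 1))]

end

/-! ### Cochains -/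

/-- Functions of `m` pairs `(xᵢ, yᵢ)` (standing for the decomposable bivectors `xᵢ ∧ yᵢ`) and of
one further vector. -/
abbrev RawCochain (V W : Type*) (m : ℕ) : Type _ := (Fin m → V × V) → V → W

/-- `f` represents an element of `Hom(⋀²V ⊗ ⋯ ⊗ ⋀²V ∧ V, W)` (with `m` factors `⋀²V`): it is linear
in each of its `2m + 1` arguments, alternating in each pair, and alternating in the last three
arguments. -/
structure IsCochain (K : Type*) {V W : Type*} [Field K] [AddCommGroup V] [Module K V]
    [AddCommGroup W] [Module K W] {m : ℕ} (f : RawCochain V W m) : Prop where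
  linear_last : ∀ X, IsLinearMap K (fun z => f X z)
  linear_fst : ∀ X i y z, IsLinearMap K (fun x => f (update X i (x, y)) z)
  linear_snd : ∀ X i x z, IsLinearMap K (fun y => f (update X i (x, y)) z)
  alternating : ∀ X i z, (X i).1 = (X i).2 → f X z = 0
  alternating_last : ∀ X (i : Fin m) z, (i : ℕ) + 1 = m → (X i).2 = z → f X z = 0

/-- The space `Hom(⋀²V ⊗ ⋯ ⊗ ⋀²V ∧ V, W)` with `m` factors `⋀²V`. -/
def Cochain (K V W : Type*) [Field K] [AddCommGroup V] [Module K V]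
    [AddCommGroup W] [Module K W] (m : ℕ) : Submodule K (RawCochain V W m) where
  carrier := {f | IsCochain K f}
  add_mem' := by
    intro a b ha hb
    constructor
    · exact fun X => linear_add (ha.linear_last X) (hb.linear_last X)
    · exact fun X i y z => linear_add (ha.linear_fst X i y z) (hb.linear_fst X i y z)
    · exact fun X i y z => linear_add (ha.linear_snd X i y z) (hb.linear_snd X i y z)
    · exact fun X i z h => by simp [ha.alternating X i z h, hb.alternating X i z h]
    · exact fun X i z h h' => by
        simp [ha.alternating_last X i z h h', hb.alternating_last X i z h h']
  zero_mem' := by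
    constructor
    · exact fun X => (0 : V →ₗ[K] W).isLinear
    · exact fun X i y z => (0 : V →ₗ[K] W).isLinear
    · exact fun X i y z => (0 : V →ₗ[K] W).isLinear
    · exact fun X i z h => rfl
    · exact fun X i z h h' => rfl
  smul_mem' := by
    intro c a ha
    constructor
    · exact fun X => linear_smul c (ha.linear_last X)
    · exact fun X i y z => linear_smul c (ha.linear_fst X i y z)
    · exact fun X i y z => linear_smul c (ha.linear_snd X i y z)
    · exact fun X i z h => by simp [ha.alternating X i z h]
    · exact fun X i z h h' => by simp [ha.alternating_last X i z h h']

/-! ### The coboundary operator -/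

section

variable {K V W : Type*} [Field K] [AddCommGroup V] [Module K V] [AddCommGroup W] [Module K W]

/-- The formula of the coboundary operator of the bracket `br` on `V` with coefficients in
`ρ : ⋀²V → 𝔤𝔩(W)`, on a cochain with `m` bivector arguments, that is, on an `n`-cochain
with `n = m + 1`. The indices `j`, `k` run from `0` to `n - 1`, so that every sign `(-1)^j` of the
formula with indices from `1` to `n` becomes `(-1)^(j+1)`. -/
def coboundaryFun (br : V [⋀^Fin 3]→ₗ[K] V) (ρ : V [⋀^Fin 2]→ₗ[K] Module.End K W) {m : ℕ}
    (f : RawCochain V W m) : RawCochain V W (m + 1) := fun X z =>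
  (∑ j : Fin (m + 1), ∑ k : Fin (m + 1), if j < k then
    (-1 : K) ^ ((j : ℕ) + 1) •
      (f (j.removeNth (update X k (br ![(X j).1, (X j).2, (X k).1], (X k).2))) z +
        f (j.removeNth (update X k ((X k).1, br ![(X j).1, (X j).2, (X k).2]))) z) else 0) +
  (∑ j : Fin (m + 1),
    (-1 : K) ^ ((j : ℕ) + 1) • f (j.removeNth X) (br ![(X j).1, (X j).2, z])) +
  (∑ j : Fin (m + 1),
    (-1 : K) ^ (j : ℕ) • ρ ![(X j).1, (X j).2] (f (j.removeNth X) z)) +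
  (-1 : K) ^ m •
    (ρ ![(X (Fin.last m)).2, z] (f (Fin.init X) (X (Fin.last m)).1) +
      ρ ![z, (X (Fin.last m)).1] (f (Fin.init X) (X (Fin.last m)).2))

theorem isCochain_swap {m : ℕ} {f : RawCochain V W m} (hf : IsCochain K f)
    (X : Fin m → V × V) (i : Fin m) (x y z : V) :
    f (update X i (x, y)) z = -f (update X i (y, x)) z := by
  have h := hf.alternating (update X i (x + y, x + y)) i z (by simp)
  have e1 : ∀ t : V, f (update X i (t, t)) z = 0 :=
    fun t => hf.alternating _ i z (by simp)
  rw [(hf.linear_fst X i _ z).map_add, (hf.linear_snd X i _ z).map_add,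
    (hf.linear_snd X i _ z).map_add, e1, e1, zero_add, add_zero] at h
  exact eq_neg_of_add_eq_zero_left h

theorem isCochain_swap_last {m : ℕ} {f : RawCochain V W m} (hf : IsCochain K f)
    (X : Fin m → V × V) (i : Fin m) (hi : (i : ℕ) + 1 = m) (x y z : V) :
    f (update X i (x, y)) z = -f (update X i (x, z)) y := by
  have e1 : ∀ t : V, f (update X i (x, t)) t = 0 :=
    fun t => hf.alternating_last _ i t hi (by simp)
  have h := e1 (y + z)
  rw [(hf.linear_snd X i _ _).map_add, (hf.linear_last _).map_add,
    (hf.linear_last _).map_add, e1, e1, zero_add, add_zero] at h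
  exact eq_neg_of_add_eq_zero_left h

theorem isCochain_coboundaryFun (br : V [⋀^Fin 3]→ₗ[K] V) (ρ : V [⋀^Fin 2]→ₗ[K] Module.End K W)
    {m : ℕ} {f : RawCochain V W m} (hf : IsCochain K f) :
    IsCochain K (coboundaryFun br ρ f) := by
  have h0 : ∀ {U : Type _} [AddCommGroup U] [Module K U], IsLinearMap K (fun _ : U => (0 : W)) :=
    fun {U} _ _ => (0 : U →ₗ[K] W).isLinear
  have hend : ∀ A : Module.End K W, IsLinearMap K (fun w => A w) := fun A => A.isLinear
  have hinit : ∀ X : Fin (m + 1) → V × V, Fin.init X = (Fin.last m).removeNth X :=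
    fun X => (Fin.removeNth_last X).symm
  constructor
  · intro X
    refine linear_add (linear_add (linear_add (linear_sum _ fun j _ => linear_sum _ fun k _ => ?_)
      (linear_sum _ fun j _ => ?_)) (linear_sum _ fun j _ => ?_)) ?_
    · split_ifs
      · exact linear_smul _ (linear_add (hf.linear_last _) (hf.linear_last _))
      · exact h0
    · exact linear_smul _ (linear_comp (hf.linear_last _) (alt3_linear_trd br _ _))
    · exact linear_smul _ (linear_comp (hend _) (hf.linear_last _))
    · exact linear_smul _ (linear_add (linear_apply (alt2_linear_snd ρ _) _)
        (linear_apply (alt2_linear_fst ρ _) _))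
  · intro X i y z
    refine linear_add (linear_add (linear_add (linear_sum _ fun j _ => linear_sum _ fun k _ => ?_)
      (linear_sum _ fun j _ => ?_)) (linear_sum _ fun j _ => ?_)) ?_
    · split_ifs with hjk
      · obtain ⟨k, rfl⟩ := Fin.exists_succAbove_eq hjk.ne'
        simp only [Fin.removeNth_update_succAbove]
        refine linear_smul _ ?_
        by_cases hij : i = j
        · subst hij
          simp only [Fin.removeNth_update, update_self, update_of_ne (Fin.succAbove_ne i k)]
          exact linear_add (linear_comp (hf.linear_fst _ k _ z) (alt3_linear_fst br _ _))
            (linear_comp (hf.linear_snd _ k _ z) (alt3_linear_fst br _ _))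
        · obtain ⟨i, rfl⟩ := Fin.exists_succAbove_eq hij
          simp only [Fin.removeNth_update_succAbove, update_of_ne (Fin.succAbove_ne j i).symm]
          by_cases hik : i = k
          · subst hik
            simp only [update_self, update_idem]
            exact linear_add (linear_comp (hf.linear_fst _ i _ z) (alt3_linear_trd br _ _))
              (hf.linear_fst _ i _ z)
          · have hne : j.succAbove k ≠ j.succAbove i :=
              fun h => hik (Fin.succAbove_right_injective h).symm
            simp only [update_of_ne hne, update_comm hik]
            exact linear_add (hf.linear_fst _ i _ z) (hf.linear_fst _ i _ z)
      · exact h0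
    · refine linear_smul _ ?_
      by_cases hij : i = j
      · subst hij
        simp only [Fin.removeNth_update, update_self]
        exact linear_comp (hf.linear_last _) (alt3_linear_fst br _ _)
      · obtain ⟨i, rfl⟩ := Fin.exists_succAbove_eq hij
        simp only [Fin.removeNth_update_succAbove, update_of_ne (Fin.succAbove_ne j i).symm]
        exact hf.linear_fst _ i _ _
    · refine linear_smul _ ?_
      by_cases hij : i = j
      · subst hij
        simp only [Fin.removeNth_update, update_self]
        exact linear_apply (alt2_linear_fst ρ _) _
      · obtain ⟨i, rfl⟩ := Fin.exists_succAbove_eq hij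
        simp only [Fin.removeNth_update_succAbove, update_of_ne (Fin.succAbove_ne j i).symm]
        exact linear_comp (hend _) (hf.linear_fst _ i _ _)
    · refine linear_smul _ ?_
      simp only [hinit]
      by_cases hij : i = Fin.last m
      · subst hij
        simp only [Fin.removeNth_update, update_self]
        exact linear_add (linear_comp (hend _) (hf.linear_last _))
          (linear_apply (alt2_linear_snd ρ _) _)
      · obtain ⟨i, rfl⟩ := Fin.exists_succAbove_eq hij
        simp only [Fin.removeNth_update_succAbove,
          update_of_ne (Fin.succAbove_ne (Fin.last m) i).symm]
        exact linear_add (linear_comp (hend _) (hf.linear_fst _ i _ _))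
          (linear_comp (hend _) (hf.linear_fst _ i _ _))
  · intro X i y z
    refine linear_add (linear_add (linear_add (linear_sum _ fun j _ => linear_sum _ fun k _ => ?_)
      (linear_sum _ fun j _ => ?_)) (linear_sum _ fun j _ => ?_)) ?_
    · split_ifs with hjk
      · obtain ⟨k, rfl⟩ := Fin.exists_succAbove_eq hjk.ne'
        simp only [Fin.removeNth_update_succAbove]
        refine linear_smul _ ?_
        by_cases hij : i = j
        · subst hij
          simp only [Fin.removeNth_update, update_self, update_of_ne (Fin.succAbove_ne i k)]
          exact linear_add (linear_comp (hf.linear_fst _ k _ z) (alt3_linear_snd br _ _))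
            (linear_comp (hf.linear_snd _ k _ z) (alt3_linear_snd br _ _))
        · obtain ⟨i, rfl⟩ := Fin.exists_succAbove_eq hij
          simp only [Fin.removeNth_update_succAbove, update_of_ne (Fin.succAbove_ne j i).symm]
          by_cases hik : i = k
          · subst hik
            simp only [update_self, update_idem]
            exact linear_add (hf.linear_snd _ i _ z)
              (linear_comp (hf.linear_snd _ i _ z) (alt3_linear_trd br _ _))
          · have hne : j.succAbove k ≠ j.succAbove i :=
              fun h => hik (Fin.succAbove_right_injective h).symm
            simp only [update_of_ne hne, update_comm hik]
            exact linear_add (hf.linear_snd _ i _ z) (hf.linear_snd _ i _ z)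
      · exact h0
    · refine linear_smul _ ?_
      by_cases hij : i = j
      · subst hij
        simp only [Fin.removeNth_update, update_self]
        exact linear_comp (hf.linear_last _) (alt3_linear_snd br _ _)
      · obtain ⟨i, rfl⟩ := Fin.exists_succAbove_eq hij
        simp only [Fin.removeNth_update_succAbove, update_of_ne (Fin.succAbove_ne j i).symm]
        exact hf.linear_snd _ i _ _
    · refine linear_smul _ ?_
      by_cases hij : i = j
      · subst hij
        simp only [Fin.removeNth_update, update_self]
        exact linear_apply (alt2_linear_snd ρ _) _
      · obtain ⟨i, rfl⟩ := Fin.exists_succAbove_eq hij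
        simp only [Fin.removeNth_update_succAbove, update_of_ne (Fin.succAbove_ne j i).symm]
        exact linear_comp (hend _) (hf.linear_snd _ i _ _)
    · refine linear_smul _ ?_
      simp only [hinit]
      by_cases hij : i = Fin.last m
      · subst hij
        simp only [Fin.removeNth_update, update_self]
        exact linear_add (linear_apply (alt2_linear_fst ρ _) _)
          (linear_comp (hend _) (hf.linear_last _))
      · obtain ⟨i, rfl⟩ := Fin.exists_succAbove_eq hij
        simp only [Fin.removeNth_update_succAbove,
          update_of_ne (Fin.succAbove_ne (Fin.last m) i).symm]
        exact linear_add (linear_comp (hend _) (hf.linear_snd _ i _ _))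
          (linear_comp (hend _) (hf.linear_snd _ i _ _))
  · intro X i z h
    have hrem : ∀ j w, j ≠ i → f (j.removeNth X) w = 0 := by
      intro j w hji
      obtain ⟨i, rfl⟩ := Fin.exists_succAbove_eq hji.symm
      exact hf.alternating _ i _ h
    have hbr : ∀ w, br ![(X i).1, (X i).2, w] = 0 := by
      intro w; rw [h]; exact alt3_self_fst br _ _
    unfold coboundaryFun
    rw [Finset.sum_eq_zero, Finset.sum_eq_zero, Finset.sum_eq_zero]
    · simp only [hinit, add_zero, zero_add]
      by_cases hi : Fin.last m = i
      · subst hi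
        rw [h, alt2_swap ρ z]
        simp
      · rw [hrem _ _ hi, hrem _ _ hi]
        simp
    · intro j _
      by_cases hj : j = i
      · subst hj; rw [h, alt2_self]; simp
      · simp [hrem _ _ hj]
    · intro j _
      by_cases hj : j = i
      · subst hj; rw [hbr, (hf.linear_last _).map_zero, smul_zero]
      · simp [hrem _ _ hj]
    · intro j _
      refine Finset.sum_eq_zero fun k _ => ?_
      split_ifs with hjk
      swap
      · rfl
      obtain ⟨k, rfl⟩ := Fin.exists_succAbove_eq hjk.ne'
      simp only [Fin.removeNth_update_succAbove]
      by_cases hij : i = j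
      · subst hij
        rw [hbr, hbr, (hf.linear_fst _ k _ z).map_zero, (hf.linear_snd _ k _ z).map_zero]
        simp
      · obtain ⟨i, rfl⟩ := Fin.exists_succAbove_eq hij
        by_cases hik : i = k
        · subst hik
          rw [← h, isCochain_swap hf]
          simp
        · rw [hf.alternating _ i, hf.alternating _ i]
          · simp
          · rw [update_of_ne hik]; exact h
          · rw [update_of_ne hik]; exact h
  · intro X i z hi hz
    obtain rfl : i = Fin.last m := Fin.ext (by simpa using hi)
    subst hz
    have hk : ∀ (j : Fin (m + 1)) (k : Fin m), j.succAbove k = Fin.last m → (k : ℕ) + 1 = m := by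
      intro j k h
      have h1 := congrArg Fin.val h
      have h2 := k.isLt
      simp only [Fin.succAbove, Fin.val_last] at h1
      split_ifs at h1 <;> simp at h1 <;> omega
    have hrem : ∀ j : Fin (m + 1), j ≠ Fin.last m →
        f (j.removeNth X) (X (Fin.last m)).2 = 0 := by
      intro j hj
      obtain ⟨k, h⟩ := Fin.exists_succAbove_eq hj.symm
      refine hf.alternating_last _ k _ (hk j k h) ?_
      rw [Fin.removeNth_apply, h]
    unfold coboundaryFun
    rw [add_assoc (_ + _), ← Finset.sum_add_distrib, Finset.sum_eq_zero, zero_add]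
    · rw [Finset.sum_eq_single (Fin.last m) (fun j _ hj => by rw [hrem j hj]; simp) (by simp),
        alt2_self, alt2_swap ρ (X (Fin.last m)).2, hinit]
      simp only [LinearMap.zero_apply, LinearMap.neg_apply, zero_add, smul_neg, Fin.val_last,
        add_neg_cancel]
    · intro j _
      by_cases hj : j = Fin.last m
      · subst hj
        rw [alt3_self_snd, (hf.linear_last _).map_zero, smul_zero, add_zero]
        exact Finset.sum_eq_zero fun k _ => if_neg (not_lt.mpr (Fin.le_last k))
      · rw [Finset.sum_eq_single (Fin.last m), if_pos (lt_of_le_of_ne (Fin.le_last j) hj),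
          ← smul_add]
        · obtain ⟨k, h⟩ := Fin.exists_succAbove_eq (Ne.symm hj)
          rw [← h, Fin.removeNth_update_succAbove, Fin.removeNth_update_succAbove, h,
            hf.alternating_last _ k _ (hk j k h) (by simp), isCochain_swap_last hf _ k (hk j k h)]
          have e : update (j.removeNth X) k ((X (Fin.last m)).1, (X (Fin.last m)).2) =
              j.removeNth X := by
            rw [update_eq_self_iff, Fin.removeNth_apply, h]
          rw [e]
          simp
        · intro l _ hl
          split_ifs with hjl
          swap
          · rfl
          have hz : ∀ w, f (j.removeNth (update X l w)) (X (Fin.last m)).2 = 0 := by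
            intro w
            obtain ⟨k, h⟩ := Fin.exists_succAbove_eq (Ne.symm hj)
            refine hf.alternating_last _ k _ (hk j k h) ?_
            rw [Fin.removeNth_apply, h, update_of_ne (Ne.symm hl)]
          rw [hz, hz, add_zero, smul_zero]
        · simp

/-- The coboundary operator `Cⁿ(V; W) → Cⁿ⁺¹(V; W)`, `n = m + 1`. -/
def coboundary (br : V [⋀^Fin 3]→ₗ[K] V) (ρ : V [⋀^Fin 2]→ₗ[K] Module.End K W) {m : ℕ}
    (f : Cochain K V W m) : Cochain K V W (m + 1) :=
  ⟨coboundaryFun br ρ f.1, isCochain_coboundaryFun br ρ f.2⟩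

end

/-! ### The graded Lie bracket on `C*(V, V)` -/

/-- The shuffles `𝕊(a, b)`. -/
def shuffles (a b : ℕ) : Finset (Equiv.Perm (Fin (a + b))) :=
  {σ | StrictMono (fun i : Fin a => σ (Fin.castAdd b i)) ∧
    StrictMono (fun i : Fin b => σ (Fin.natAdd a i))}

/-- Transport along an equality of degrees. -/
def RawCochain.cast {V W : Type*} {m n : ℕ} (e : m = n) (f : RawCochain V W m) :
    RawCochain V W n :=
  fun X z => f (fun i => X (Fin.cast e i)) z

section

variable {V : Type*} [AddCommGroup V]

/-- The list of arguments of `P` in the term of index `k` of `P ∘ Q` (indices from `0`):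
`𝔛_{σ(0)}, …, 𝔛_{σ(k-1)}, (a ∧ b), 𝔛_{k+q+1}, …, 𝔛_{p+q-1}`. -/
def insertArgs {p q : ℕ} (k : Fin p) (σ : Equiv.Perm (Fin ((k : ℕ) + q)))
    (X : Fin (p + q) → V × V) (ab : V × V) : Fin p → V × V := fun i =>
  if hi : (i : ℕ) < k then X (Fin.castLE (by omega) (σ ⟨i, by omega⟩))
  else if i = k then ab
  else X ⟨(i : ℕ) + q, by omega⟩

/-- The composition `P ∘ Q ∈ C^{p+q}(V,V)` of `P ∈ C^p(V,V)` and `Q ∈ C^q(V,V)`. With `k` running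
from `0` to `p - 1`, the bivector `𝔛_{k+q}` is the one that is hit by `Q`. -/
def circ {p q : ℕ} (P : RawCochain V V p) (Q : RawCochain V V q) : RawCochain V V (p + q) :=
  fun X z =>
    (∑ k : Fin p, ∑ σ ∈ shuffles (k : ℕ) q,
      ((-1 : ℤ) ^ ((k : ℕ) * q) * (Equiv.Perm.sign σ : ℤ)) •
        P (insertArgs k σ X
          (Q (fun i => X (Fin.castLE (by omega) (σ (Fin.natAdd (k : ℕ) i))))
            (X ⟨(k : ℕ) + q, by omega⟩).1, (X ⟨(k : ℕ) + q, by omega⟩).2)) z) +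
    (∑ k : Fin p, ∑ σ ∈ shuffles (k : ℕ) q,
      ((-1 : ℤ) ^ ((k : ℕ) * q) * (Equiv.Perm.sign σ : ℤ)) •
        P (insertArgs k σ X
          ((X ⟨(k : ℕ) + q, by omega⟩).1,
            Q (fun i => X (Fin.castLE (by omega) (σ (Fin.natAdd (k : ℕ) i))))
              (X ⟨(k : ℕ) + q, by omega⟩).2)) z) +
    ∑ σ ∈ shuffles p q,
      ((-1 : ℤ) ^ (p * q) * (Equiv.Perm.sign σ : ℤ)) •
        P (fun i => X (σ (Fin.castAdd q i))) (Q (fun i => X (σ (Fin.natAdd p i))) z)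

/-- The graded commutator bracket `[P, Q] = P ∘ Q - (-1)^{pq} Q ∘ P`. -/
def gradedBracket {p q : ℕ} (P : RawCochain V V p) (Q : RawCochain V V q) :
    RawCochain V V (p + q) :=
  circ P Q - (-1 : ℤ) ^ (p * q) • (circ Q P).cast (Nat.add_comm q p)

end

/-! ### The L∞-algebra `C*(h, g)` and its twist -/

section

variable {K g h : Type*} [Field K] [AddCommGroup g] [Module K g] [AddCommGroup h] [Module K h]
  {A : ThreeLieAlgebra K g} {B : ThreeLieAlgebra K h}

/-- The element `Δ = π + ρ + λμ` of `C¹(g ⊕ h, g ⊕ h)`. -/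
def semidirect (R : Action A B) (lam : K) : RawCochain (g × h) (g × h) 1 := fun X Z =>
  (A.bracket ![(X 0).1.1, (X 0).2.1, Z.1],
    R.rho ![(X 0).1.1, (X 0).2.1] Z.2 + R.rho ![(X 0).2.1, Z.1] (X 0).1.2 +
      R.rho ![Z.1, (X 0).1.1] (X 0).2.2 + lam • B.bracket ![(X 0).1.2, (X 0).2.2, Z.2])

/-- The inclusion of `C*(h, g)` into `C*(g ⊕ h, g ⊕ h)`. -/
def incl {m : ℕ} (f : RawCochain h g m) : RawCochain (g × h) (g × h) m := fun X Z =>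
  (f (fun i => ((X i).1.2, (X i).2.2)) Z.2, 0)

/-- The projection `𝒫` of `C*(g ⊕ h, g ⊕ h)` onto its subspace `C*(h, g)`, with values regarded as
elements of `C*(h, g)`: restrict the arguments to `h` and take the `g`-component of the value. -/
def proj {m : ℕ} (F : RawCochain (g × h) (g × h) m) : RawCochain h g m := fun X z =>
  (F (fun i => ((0, (X i).1), (0, (X i).2))) (0, z)).1

/-- `l₁(P) = 𝒫[Δ, P]`. -/
def l1 (R : Action A B) (lam : K) {m : ℕ} (P : RawCochain h g m) : RawCochain h g (m + 1) :=
  (proj (gradedBracket (semidirect R lam) (incl P))).cast (by omega)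

/-- `l₃(P, Q, S) = 𝒫[[[Δ, P], Q], S]`. -/
def l3 (R : Action A B) (lam : K) {m n k : ℕ} (P : RawCochain h g m) (Q : RawCochain h g n)
    (S : RawCochain h g k) : RawCochain h g (m + n + k + 1) :=
  (proj (gradedBracket (gradedBracket (gradedBracket (semidirect R lam) (incl P)) (incl Q))
    (incl S))).cast (by omega)

/-- A linear map `T : h → g` as an element of `C⁰(h, g)`. -/
def ofLinearMap (T : h →ₗ[K] g) : RawCochain h g 0 := fun _ z => T z

/-- The differential `l₁ᵀ(P) = l₁(P) + ½ l₃(T, T, P)` of the L∞-algebra twisted by `T`. -/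
def l1Twisted (R : Action A B) (lam : K) (T : h →ₗ[K] g) {m : ℕ} (P : RawCochain h g m) :
    RawCochain h g (m + 1) :=
  l1 R lam P + (1 / 2 : K) • (l3 R lam (ofLinearMap T) (ofLinearMap T) P).cast (by omega)

/-- The coboundary operator `d_T` of the descendent 3-Lie algebra `(h, [·,·,·]_T)` with
coefficients in `(g; ϱ)`. -/
def dT (R : Action A B) (lam : K) (T : h →ₗ[K] g) {m : ℕ} (f : Cochain K h g m) :
    Cochain K h g (m + 1) :=
  coboundary (descendentBracket R lam T) (inducedRho R T) f

end

end ThreeLie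

namespace ThreeLie

open Function

/-! Since `½ l₃(T, T, f)` is half the projection of `[[[Δ, T], T], f]`, the twisted differential of
`f` is the projection of the bracket of `f` with the single degree-one element `Δ + ½[[Δ, T], T]`.
For any degree-one `P`, the projection of `[P, f]`, multiplied by `(-1)^m`, consists of the same
four groups of terms as the coboundary formula (`smul_proj_gradedBracket_incl`). The `h`-part of `P`
on three vectors of `h` plays the role of the bracket, and the `g`-part of `P` on two vectors of `h`
and one of `g` plays the role of the representation. This expansion is explicit because the only
shuffles involved have an empty block or a block of size one, so that one index determines each of
them.

It remains to evaluate the two summands of `P` (`semidirect_apply`, `twice_apply`). On three vectors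
of `h`, `Δ` contributes `λ[u,v,w]` and `½[[Δ, T], T]` contributes the three terms `ρ(T·,T·)·`;
together they form the descendent bracket. On two vectors of `h` and one of `g`, the `g`-part of `Δ`
vanishes and that of `½[[Δ, T], T]` is `ϱ`. The two summands are expanded separately, so
multilinearity of `f` is used to split its values on descendent brackets; characteristic `0` serves
to divide by `2`. -/

/-! ### Shuffles with an empty block or a block of size one -/

theorem shuffles_zero_left (q : ℕ) : shuffles 0 q = {1} := by
  ext σ
  simp only [shuffles, Finset.mem_filter, Finset.mem_univ, true_and, Finset.mem_singleton]
  constructor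
  · rintro ⟨-, h⟩
    have h1 : (fun i : Fin q => σ (Fin.natAdd 0 i)) = fun i : Fin q => Fin.natAdd 0 i := by
      refine (h.range_inj (Fin.strictMono_natAdd 0)).1 ?_
      have hs : Surjective (fun i : Fin q => Fin.natAdd 0 i) := fun i =>
        ⟨⟨i, by have := i.isLt; omega⟩, Fin.ext (by simp)⟩
      rw [hs.range_eq]
      exact (σ.surjective.comp hs).range_eq
    ext i
    have h2 := congrFun h1 ⟨i, by have := i.isLt; omega⟩
    have h3 : Fin.natAdd 0 (⟨i, by have := i.isLt; omega⟩ : Fin q) = i := Fin.ext (by simp)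
    simp only [h3] at h2
    simp [h2]
  · rintro rfl
    exact ⟨fun i => i.elim0, Fin.strictMono_natAdd 0⟩

/-- The `(k, 1)`-shuffle with last value `j`. -/
def lastShuffle {k : ℕ} (j : Fin (k + 1)) : Equiv.Perm (Fin (k + 1)) :=
  j.cycleRange.symm * finRotate (k + 1)

/-- The rotation moves the last position to `0` and every other `i` to `i + 1`; the inverse cycle
then sends `0` to `j` and the successors increasingly onto the complement of `j`. -/
theorem lastShuffle_last {k : ℕ} (j : Fin (k + 1)) : lastShuffle j (Fin.natAdd k 0) = j := by
  have : Fin.natAdd k 0 = Fin.last k := rfl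
  rw [this, lastShuffle, Equiv.Perm.mul_apply, finRotate_last, Fin.cycleRange_symm_zero]

theorem lastShuffle_castAdd {k : ℕ} (j : Fin (k + 1)) (i : Fin k) :
    lastShuffle j (Fin.castAdd 1 i) = j.succAbove i := by
  have : finRotate (k + 1) (Fin.castAdd 1 i) = i.succ := by
    rw [← Fin.castSucc, finRotate_apply, Fin.coeSucc_eq_succ]
  rw [lastShuffle, Equiv.Perm.mul_apply, this, Fin.cycleRange_symm_succ]

theorem sign_lastShuffle {k : ℕ} (j : Fin (k + 1)) :
    (Equiv.Perm.sign (lastShuffle j) : ℤ) = (-1) ^ ((j : ℕ) + k) := by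
  rw [lastShuffle, Equiv.Perm.sign_mul, Equiv.Perm.sign_symm, Fin.sign_cycleRange,
    sign_finRotate]
  simp [pow_add]

theorem range_shuffle_left {k : ℕ} (σ : Equiv.Perm (Fin (k + 1))) :
    Set.range (fun i : Fin k => σ (Fin.castAdd 1 i)) = {σ (Fin.last k)}ᶜ := by
  have : (fun i : Fin k => σ (Fin.castAdd 1 i)) = σ ∘ (Fin.last k).succAbove := by
    ext i; simp [Fin.succAbove_last]; rfl
  rw [this, Set.range_comp, Fin.range_succAbove, Set.image_compl_eq σ.bijective,
    Set.image_singleton]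

/-- Once the last value of a `(k, 1)`-shuffle is chosen, the first `k` values must enumerate its
complement increasingly, and a strictly monotone map on `Fin k` is determined by its range. -/
theorem sum_shuffles_one_right {M : Type*} [AddCommMonoid M] (k : ℕ)
    (G : Equiv.Perm (Fin (k + 1)) → M) :
    ∑ σ ∈ shuffles k 1, G σ = ∑ j : Fin (k + 1), G (lastShuffle j) := by
  symm
  refine Finset.sum_nbij lastShuffle ?_ ?_ ?_ fun _ _ => rfl
  · intro j _
    simp only [shuffles, Finset.mem_filter, Finset.mem_univ, true_and, lastShuffle_castAdd]
    exact ⟨Fin.strictMono_succAbove j, Subsingleton.strictMono _⟩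
  · intro i _ j _ h
    rw [← lastShuffle_last i, h, lastShuffle_last]
  · intro σ hσ
    simp only [shuffles, Finset.coe_filter, Finset.mem_univ, true_and, Set.mem_ofPred_eq] at hσ
    refine ⟨σ (Fin.last k), by simp, Equiv.ext fun i => ?_⟩
    have h := (hσ.1.range_inj (Fin.strictMono_succAbove (σ (Fin.last k)))).1
      (by rw [range_shuffle_left, Fin.range_succAbove])
    induction i using Fin.lastCases with
    | last => exact lastShuffle_last _
    | cast i => exact (lastShuffle_castAdd _ i).trans (congrFun h i).symm

/-- The `(1, m)`-shuffle with first value `j`. -/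
def firstShuffle {m : ℕ} (j : Fin (m + 1)) : Equiv.Perm (Fin (1 + m)) :=
  (finCongr (Nat.add_comm m 1)).permCongr j.cycleRange.symm

theorem firstShuffle_castAdd {m : ℕ} (j : Fin (m + 1)) (i : Fin 1) :
    firstShuffle j (Fin.castAdd m i) = Fin.cast (Nat.add_comm m 1) j := by
  have : (finCongr (Nat.add_comm m 1)).symm (Fin.castAdd m i) = 0 := by
    ext; simp
  rw [firstShuffle, Equiv.permCongr_apply, this, Fin.cycleRange_symm_zero]
  rfl

theorem firstShuffle_natAdd {m : ℕ} (j : Fin (m + 1)) (i : Fin m) :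
    firstShuffle j (Fin.natAdd 1 i) = Fin.cast (Nat.add_comm m 1) (j.succAbove i) := by
  have : (finCongr (Nat.add_comm m 1)).symm (Fin.natAdd 1 i) = i.succ := by
    ext; simp
  rw [firstShuffle, Equiv.permCongr_apply, this, Fin.cycleRange_symm_succ]
  rfl

/-- Reindexing `Fin (m + 1)` as `Fin (1 + m)` preserves signs, so only the cycle of length `j + 1`
contributes. -/
theorem sign_firstShuffle {m : ℕ} (j : Fin (m + 1)) :
    (Equiv.Perm.sign (firstShuffle j) : ℤ) = (-1) ^ (j : ℕ) := by
  rw [firstShuffle, Equiv.Perm.sign_permCongr, Equiv.Perm.sign_symm, Fin.sign_cycleRange]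
  simp

theorem sum_shuffles_one_left {M : Type*} [AddCommMonoid M] (m : ℕ)
    (G : Equiv.Perm (Fin (1 + m)) → M) :
    ∑ σ ∈ shuffles 1 m, G σ = ∑ j : Fin (m + 1), G (firstShuffle j) := by
  symm
  refine Finset.sum_nbij firstShuffle ?_ ?_ ?_ fun _ _ => rfl
  · intro j _
    simp only [shuffles, Finset.mem_filter, Finset.mem_univ, true_and, firstShuffle_natAdd]
    exact ⟨Subsingleton.strictMono _, fun a b h => Fin.strictMono_succAbove j h⟩
  · intro i _ j _ h
    have := firstShuffle_castAdd i 0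
    rw [h, firstShuffle_castAdd] at this
    exact (Fin.cast_injective _ this).symm
  · intro σ hσ
    simp only [shuffles, Finset.coe_filter, Finset.mem_univ, true_and, Set.mem_ofPred_eq] at hσ
    set e := Fin.cast (Nat.add_comm 1 m) with he
    -- Transporting `σ` to `Fin (m + 1)` makes `0` and `succ` available; the index sought is the
    -- first value `τ 0`.
    set τ : Equiv.Perm (Fin (m + 1)) := (finCongr (Nat.add_comm 1 m)).permCongr σ with hτ
    have hs : ∀ i : Fin m, e (σ (Fin.natAdd 1 i)) = τ i.succ := by
      intro i
      have : (finCongr (Nat.add_comm 1 m)).symm i.succ = Fin.natAdd 1 i := by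
        ext; simp [add_comm]
      rw [hτ, Equiv.permCongr_apply, this]
      rfl
    have hmono : StrictMono (fun i : Fin m => e (σ (Fin.natAdd 1 i))) := fun a b h => hσ.2 h
    have h := (hmono.range_inj (Fin.strictMono_succAbove (τ 0))).1 (by
        have : (fun i : Fin m => e (σ (Fin.natAdd 1 i))) = τ ∘ (0 : Fin (m + 1)).succAbove := by
          ext i; simp [hs]
        rw [this, Set.range_comp, Fin.range_succAbove, Set.image_compl_eq τ.bijective,
          Set.image_singleton, Fin.range_succAbove])
    refine ⟨τ 0, by simp, Equiv.ext fun i => ?_⟩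
    induction i using Fin.addCases with
    | left i =>
      rw [firstShuffle_castAdd]
      have : (finCongr (Nat.add_comm 1 m)).symm 0 = Fin.castAdd m i := by
        ext; simp
      rw [hτ, Equiv.permCongr_apply, this]
      rfl
    | right i =>
      rw [firstShuffle_natAdd, ← congrFun h i]
      rfl

/-! ### Compositions and brackets with a cochain of degree one -/

/-- This turns the shuffle form of the arguments into the "replace one slot, omit another" form of
the coboundary. Because `j ≤ k`, omitting slot `j` moves the replaced slot `k + 1` to position `k`.
-/
theorem insertArgs_lastShuffle {V : Type*} {p : ℕ} (k : Fin p) (j : Fin ((k : ℕ) + 1))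
    (X : Fin (p + 1) → V × V) (ab : V × V) :
    insertArgs k (lastShuffle j) X ab =
      (Fin.castLE (by omega) j : Fin (p + 1)).removeNth (update X k.succ ab) := by
  funext i
  rw [Fin.removeNth_apply]
  have hj := j.isLt
  unfold insertArgs
  split_ifs with h1 h2
  · have := lastShuffle_castAdd j ⟨i, h1⟩
    simp only [Fin.castAdd_mk] at this
    rw [this]
    have e : Fin.castLE (by omega) (j.succAbove ⟨i, h1⟩) =
        (Fin.castLE (by omega) j : Fin (p + 1)).succAbove i := by
      ext
      simp only [Fin.succAbove, Fin.lt_def, Fin.val_castLE, Fin.val_castSucc]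
      split_ifs <;> simp
    rw [← e, update_of_ne]
    intro h
    have := congrArg Fin.val h
    have h3 := (j.succAbove ⟨i, h1⟩).isLt
    simp only [Fin.val_castLE, Fin.val_succ] at this
    omega
  · subst h2
    rw [Fin.succAbove_of_le_castSucc _ _ (by rw [Fin.le_def]; simp; omega), update_self]
  · have h3 : (k : ℕ) < i := by
      rcases lt_trichotomy (i : ℕ) k with h | h | h
      · exact absurd h h1
      · exact absurd (Fin.ext h) h2
      · exact h
    rw [Fin.succAbove_of_le_castSucc _ _ (by rw [Fin.le_def]; simp; omega), update_of_ne]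
    · rfl
    · intro h
      exact h2 (Fin.succ_injective _ h)

/-- A pair `j < k'` has `k' = k + 1` for a unique `k`, and then `j` runs through `Fin (k + 1)`,
which is exactly the index set of the `(k, 1)`-shuffles. -/
theorem sum_lt_eq_sum_castLE {M : Type*} [AddCommMonoid M] {m : ℕ}
    (G : Fin (m + 1) → Fin (m + 1) → M) :
    ∑ j, ∑ k, (if j < k then G j k else 0) =
      ∑ k : Fin m, ∑ j : Fin ((k : ℕ) + 1), G (Fin.castLE (by omega) j) k.succ := by
  rw [Finset.sum_comm, Fin.sum_univ_succ]
  simp only [Fin.not_lt_zero, if_false, Finset.sum_const_zero, zero_add]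
  refine Finset.sum_congr rfl fun k _ => ?_
  rw [← Finset.sum_filter]
  symm
  refine Finset.sum_nbij (Fin.castLE (by omega)) ?_ ?_ ?_ fun _ _ => rfl
  · intro j _
    simp only [Finset.mem_filter, Finset.mem_univ, true_and, Fin.lt_def, Fin.val_castLE,
      Fin.val_succ]
    exact j.isLt
  · intro a _ b _ h
    exact Fin.castLE_injective _ h
  · intro j hj
    simp only [Finset.coe_filter, Finset.mem_univ, true_and, Set.mem_ofPred_eq, Fin.lt_def,
      Fin.val_succ] at hj
    exact ⟨⟨j, hj⟩, by simp, rfl⟩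

section

variable {V : Type*} [AddCommGroup V]

/-- With one bivector slot in `P`, insertion into that slot admits only the trivial shuffle, so `Q`
takes the first `m` bivectors and acts on the last one. The sum over `j` comes from the `(1,
m)`-shuffles. -/
theorem circ_one_left {m : ℕ} (P : RawCochain V V 1) (Q : RawCochain V V m)
    (X : Fin (m + 1) → V × V) (z : V) :
    circ P Q (fun i => X (Fin.cast (Nat.add_comm 1 m) i)) z =
      P (fun _ => (Q (Fin.init X) (X (Fin.last m)).1, (X (Fin.last m)).2)) z +
        P (fun _ => ((X (Fin.last m)).1, Q (Fin.init X) (X (Fin.last m)).2)) z +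
        ∑ j : Fin (m + 1), ((-1 : ℤ) ^ m * (-1) ^ (j : ℕ)) •
          P (fun _ => X j) (Q (j.removeNth X) z) := by
  have hl : ∀ h, X (Fin.cast (Nat.add_comm 1 m) ⟨0 + m, h⟩) = X (Fin.last m) := by
    intro h; congr 1; ext; simp
  have hi : (fun i : Fin m => X (Fin.cast (Nat.add_comm 1 m)
      (Fin.castLE (by omega) ((1 : Equiv.Perm (Fin (0 + m))) (Fin.natAdd 0 i))))) =
      Fin.init X := by
    funext i
    simp only [Fin.init]
    congr 1; ext; simp
  have ha : ∀ ab : V × V,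
      insertArgs (0 : Fin 1) (1 : Equiv.Perm (Fin (0 + m)))
        (fun i => X (Fin.cast (Nat.add_comm 1 m) i)) ab = fun _ => ab := by
    intro ab; funext i
    obtain rfl := Subsingleton.elim i 0
    simp [insertArgs]
  rw [circ, Fin.sum_univ_one, Fin.sum_univ_one, sum_shuffles_one_left]
  -- The block length is the value of `(0 : Fin 1)`; it has to read `0` literally before the
  -- rewrite.
  change (∑ σ ∈ shuffles 0 m, _) + (∑ σ ∈ shuffles 0 m, _) + _ = _
  rw [shuffles_zero_left, Finset.sum_singleton, Finset.sum_singleton]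
  congr 1
  · congr 1
    · refine Eq.trans ?_ (one_zsmul _)
      congr 1
      · simp
      · refine congrFun ((congrArg P (ha _)).trans ?_) z
        congr 1; funext _
        exact congr (congrArg Prod.mk (congr (congrArg Q hi) (congrArg Prod.fst (hl _))))
          (congrArg Prod.snd (hl _))
    · refine Eq.trans ?_ (one_zsmul _)
      congr 1
      · simp
      · refine congrFun ((congrArg P (ha _)).trans ?_) z
        congr 1; funext _
        exact congr (congrArg Prod.mk (congrArg Prod.fst (hl _)))
          (congr (congrArg Q hi) (congrArg Prod.snd (hl _)))
  · refine Finset.sum_congr rfl fun j _ => ?_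
    rw [sign_firstShuffle, one_mul]
    simp only [firstShuffle_castAdd, firstShuffle_natAdd, Fin.cast_cast, Fin.cast_eq_self]
    rfl

theorem circ_one_right {m : ℕ} (P : RawCochain V V m) (Q : RawCochain V V 1)
    (X : Fin (m + 1) → V × V) (z : V) :
    circ P Q X z =
      (∑ j : Fin (m + 1), ∑ k : Fin (m + 1), if j < k then (-1 : ℤ) ^ (j : ℕ) •
        (P (j.removeNth (update X k (Q (fun _ => X j) (X k).1, (X k).2))) z +
          P (j.removeNth (update X k ((X k).1, Q (fun _ => X j) (X k).2))) z) else 0) +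
      ∑ j : Fin (m + 1), (-1 : ℤ) ^ (j : ℕ) • P (j.removeNth X) (Q (fun _ => X j) z) := by
  -- The sign of the composition cancels the contribution of the rotation to the sign of the
  -- shuffle, so only the position `j` of the omitted bivector counts.
  have hs : ∀ a j : ℕ, (-1 : ℤ) ^ (a * 1) * (-1) ^ (j + a) = (-1) ^ j := by
    intro a j
    rw [mul_one, add_comm, ← pow_add, ← add_assoc, pow_add, ← two_mul, pow_mul]
    simp
  rw [circ, sum_lt_eq_sum_castLE, ← Finset.sum_add_distrib]
  congr 1
  · refine Finset.sum_congr rfl fun k _ => ?_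
    rw [sum_shuffles_one_right, sum_shuffles_one_right, ← Finset.sum_add_distrib]
    refine Finset.sum_congr rfl fun j _ => ?_
    rw [sign_lastShuffle, hs, ← smul_add, insertArgs_lastShuffle, insertArgs_lastShuffle]
    have : ∀ i : Fin 1, lastShuffle j (Fin.natAdd (k : ℕ) i) = j := by
      intro i
      obtain rfl := Subsingleton.elim i 0
      exact lastShuffle_last j
    simp only [this]
    rfl
  · rw [sum_shuffles_one_right]
    refine Finset.sum_congr rfl fun j _ => ?_
    rw [sign_lastShuffle, hs]
    have : ∀ i : Fin 1, lastShuffle j (Fin.natAdd m i) = j := by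
      intro i
      obtain rfl := Subsingleton.elim i 0
      exact lastShuffle_last j
    simp only [this, lastShuffle_castAdd]
    rfl

theorem gradedBracket_one_left {m : ℕ} (P : RawCochain V V 1) (Q : RawCochain V V m)
    (X : Fin (m + 1) → V × V) (z : V) :
    gradedBracket P Q (fun i => X (Fin.cast (Nat.add_comm 1 m) i)) z =
      P (fun _ => (Q (Fin.init X) (X (Fin.last m)).1, (X (Fin.last m)).2)) z +
        P (fun _ => ((X (Fin.last m)).1, Q (Fin.init X) (X (Fin.last m)).2)) z +
        ∑ j : Fin (m + 1), ((-1 : ℤ) ^ m * (-1) ^ (j : ℕ)) •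
          P (fun _ => X j) (Q (j.removeNth X) z) -
      (-1 : ℤ) ^ m •
        ((∑ j : Fin (m + 1), ∑ k : Fin (m + 1), if j < k then (-1 : ℤ) ^ (j : ℕ) •
          (Q (j.removeNth (update X k (P (fun _ => X j) (X k).1, (X k).2))) z +
            Q (j.removeNth (update X k ((X k).1, P (fun _ => X j) (X k).2))) z) else 0) +
        ∑ j : Fin (m + 1), (-1 : ℤ) ^ (j : ℕ) • Q (j.removeNth X) (P (fun _ => X j) z)) := by
  rw [← circ_one_left, ← circ_one_right]
  simp only [gradedBracket, one_mul]
  rfl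

/-- The bracket of `P ∈ C¹(V, V)` with `Q ∈ C⁰(V, V)`. -/
theorem gradedBracket_one_zero (P : RawCochain V V 1) (Q : RawCochain V V 0)
    (X : Fin 1 → V × V) (z : V) :
    gradedBracket P Q X z =
      P (fun _ => (Q Fin.elim0 (X 0).1, (X 0).2)) z +
        P (fun _ => ((X 0).1, Q Fin.elim0 (X 0).2)) z +
        P X (Q Fin.elim0 z) - Q Fin.elim0 (P X z) := by
  have h := gradedBracket_one_left P Q X z
  have hX : (fun _ => X 0) = X := by
    funext i; rw [Subsingleton.elim i 0]
  -- There is only one empty tuple of bivectors, so `Q` is just a map of its last argument.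
  have hQ : ∀ Y, Q Y = Q Fin.elim0 := fun Y => congrArg Q (Subsingleton.elim _ _)
  simp only [hQ] at h
  simpa [hX] using h

end

/-! ### Projection to `C*(h, g)` and comparison with the coboundary -/

section

variable {K g h : Type*} [Field K] [AddCommGroup g] [Module K g] [AddCommGroup h] [Module K h]
  {A : ThreeLieAlgebra K g} {B : ThreeLieAlgebra K h}

theorem alt3_rotate {V W : Type*} [AddCommGroup V] [Module K V] [AddCommGroup W] [Module K W]
    (f : V [⋀^Fin 3]→ₗ[K] W) (a b c : V) : f ![a, b, c] = f ![c, a, b] := by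
  have h := f.map_perm ![c, a, b] (finRotate 3)
  rw [sign_finRotate] at h
  have e : ![c, a, b] ∘ finRotate 3 = ![a, b, c] := by
    ext i; fin_cases i <;> rfl
  rw [e] at h
  simpa using h

omit [Module K h] in
/-- The projection onto `C*(h, g)` of the bracket of `P ∈ C¹(g ⊕ h, g ⊕ h)` with `f ∈ C*(h, g)`. -/
theorem smul_proj_gradedBracket_incl {m : ℕ} (P : RawCochain (g × h) (g × h) 1)
    (f : RawCochain h g m) (X : Fin (m + 1) → h × h) (z : h) :
    (-1 : K) ^ m • (proj (gradedBracket P (incl f))).cast (Nat.add_comm 1 m) X z =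
      (∑ j : Fin (m + 1), ∑ k : Fin (m + 1), if j < k then
        (-1 : K) ^ ((j : ℕ) + 1) •
          (f (j.removeNth (update X k
              ((P (fun _ => ((0, (X j).1), (0, (X j).2))) (0, (X k).1)).2, (X k).2))) z +
            f (j.removeNth (update X k ((X k).1,
              (P (fun _ => ((0, (X j).1), (0, (X j).2))) (0, (X k).2)).2))) z) else 0) +
      (∑ j : Fin (m + 1), (-1 : K) ^ ((j : ℕ) + 1) •
        f (j.removeNth X) (P (fun _ => ((0, (X j).1), (0, (X j).2))) (0, z)).2) +
      (∑ j : Fin (m + 1), (-1 : K) ^ (j : ℕ) •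
        (P (fun _ => ((0, (X j).1), (0, (X j).2))) (f (j.removeNth X) z, 0)).1) +
      (-1 : K) ^ m •
        ((P (fun _ => ((f (Fin.init X) (X (Fin.last m)).1, 0), (0, (X (Fin.last m)).2)))
            (0, z)).1 +
          (P (fun _ => ((0, (X (Fin.last m)).1), (f (Fin.init X) (X (Fin.last m)).2, 0)))
            (0, z)).1) := by
  have hz : ∀ (n : ℕ) (x : g), (-1 : ℤ) ^ n • x = (-1 : K) ^ n • x := by
    intro n x
    rw [← Int.cast_smul_eq_zsmul K]
    simp
  have hm : (-1 : K) ^ m * (-1) ^ m = 1 := by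
    rw [← mul_pow]; simp
  have hneg : ∀ (p : Prop) [Decidable p] (a : g),
      -(if p then a else 0) = if p then -a else 0 := by
    intro p _ a
    split_ifs <;> simp
  -- `incl f` sees only `h`-components, and taking these commutes with replacing and omitting slots.
  have hu : ∀ (j k : Fin (m + 1)) (a b : g × h),
      (fun i => (((j.removeNth (update (fun i => (((0 : g), (X i).1), ((0 : g), (X i).2))) k
        (a, b))) i).1.2, ((j.removeNth (update (fun i => (((0 : g), (X i).1), ((0 : g), (X i).2))) k
        (a, b))) i).2.2)) = j.removeNth (update X k (a.2, b.2)) := by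
    intro j k a b
    funext i
    simp only [Fin.removeNth_apply, update_apply]
    split_ifs <;> rfl
  have key := congrArg Prod.fst (gradedBracket_one_left P (incl f)
    (fun i => (((0 : g), (X i).1), ((0 : g), (X i).2))) (0, z))
  refine (congrArg ((-1 : K) ^ m • ·) key).trans ?_
  simp only [Prod.fst_sub, Prod.fst_add, Prod.smul_fst, Prod.fst_sum, apply_ite Prod.fst,
    incl, hu, Prod.fst_zero, mul_smul, hz]
  -- The factor `(-1)^m` cancels the sign of the graded commutator and the sign in front of the sum
  -- over `j`, and survives only on the last group. The minus sign of the commutator turns `(-1)^j`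
  -- into `(-1)^(j+1)`.
  rw [smul_sub, smul_smul _ _ (_ + _), hm, one_smul, smul_add, ← Finset.smul_sum, smul_smul, hm,
    one_smul, sub_eq_add_neg, neg_add, ← Finset.sum_neg_distrib, ← Finset.sum_neg_distrib]
  simp only [← Finset.sum_neg_distrib, pow_succ, mul_neg, mul_one, neg_smul, hneg]
  exact (add_comm _ _).trans ((congrArg _ (add_comm _ _)).trans (add_assoc _ _ _).symm)

variable (R : Action A B) (lam : K) (T : h →ₗ[K] g)

/-- The double bracket `[[Δ, T], T]`. -/
def twice : RawCochain (g × h) (g × h) 1 :=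
  gradedBracket (gradedBracket (semidirect R lam) (incl (ofLinearMap T))) (incl (ofLinearMap T))

theorem semidirect_apply (x y z : g × h) :
    semidirect R lam (fun _ => (x, y)) z = (A.bracket ![x.1, y.1, z.1],
      R.rho ![x.1, y.1] z.2 + R.rho ![y.1, z.1] x.2 + R.rho ![z.1, x.1] y.2 +
        lam • B.bracket ![x.2, y.2, z.2]) := rfl

/-- Bracketing with `T` feeds `T` into one slot or applies it to the value. Two slots can be filled
in either order, and so can one slot and the value, which explains the factors `2`. Applying `T`
twice in a row gives zero, since `T` reads `h`-components and takes values in `g`; for the same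
reason every `λ`-term dies. -/
theorem twice_apply (x y z : g × h) :
    twice R lam T (fun _ => (x, y)) z =
      ((2 : K) • (A.bracket ![T x.2, T y.2, z.1] + A.bracket ![T x.2, y.1, T z.2] +
        A.bracket ![x.1, T y.2, T z.2] -
        T (R.rho ![T x.2, y.1] z.2 + R.rho ![z.1, T x.2] y.2 +
          (R.rho ![x.1, T y.2] z.2 + R.rho ![T y.2, z.1] x.2) +
          (R.rho ![y.1, T z.2] x.2 + R.rho ![T z.2, x.1] y.2))),
      (2 : K) • (R.rho ![T x.2, T y.2] z.2 + R.rho ![T y.2, T z.2] x.2 +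
        R.rho ![T z.2, T x.2] y.2)) := by
  have z2a : ∀ a, R.rho ![0, a] = 0 := fun a => (alt2_linear_fst R.rho a).map_zero
  have z2b : ∀ a, R.rho ![a, 0] = 0 := fun a => (alt2_linear_snd R.rho a).map_zero
  have z3a : ∀ a b, B.bracket ![0, a, b] = 0 := fun a b => (alt3_linear_fst B.bracket a b).map_zero
  have z3b : ∀ a b, B.bracket ![a, 0, b] = 0 := fun a b => (alt3_linear_snd B.bracket a b).map_zero
  have z3c : ∀ a b, B.bracket ![a, b, 0] = 0 := fun a b => (alt3_linear_trd B.bracket a b).map_zero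
  have w3a : ∀ a b, A.bracket ![0, a, b] = 0 := fun a b => (alt3_linear_fst A.bracket a b).map_zero
  have w3b : ∀ a b, A.bracket ![a, 0, b] = 0 := fun a b => (alt3_linear_snd A.bracket a b).map_zero
  have w3c : ∀ a b, A.bracket ![a, b, 0] = 0 := fun a b => (alt3_linear_trd A.bracket a b).map_zero
  refine (gradedBracket_one_zero
    (gradedBracket (semidirect R lam) (incl (ofLinearMap T)) : RawCochain (g × h) (g × h) 1)
    (incl (ofLinearMap T)) _ _).trans ?_
  have hb : ∀ x y z : g × h,
      (gradedBracket (semidirect R lam) (incl (ofLinearMap T)) : RawCochain (g × h) (g × h) 1)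
        (fun _ => (x, y)) z = _ := fun x y z => gradedBracket_one_zero _ _ _ _
  simp only [hb, incl, ofLinearMap, semidirect_apply, map_zero, z2a, z2b, z3a, z3b, z3c, w3a, w3b, w3c,
    smul_zero,
    LinearMap.zero_apply]
  ext
  · simp [two_smul]
    abel
  · simp [two_smul]
    abel

/-- The order of summands separates the contribution of `Δ` from that of `½[[Δ, T], T]`. -/
theorem descendentBracket_apply (x y z : h) :
    descendentBracket R lam T ![x, y, z] = lam • B.bracket ![x, y, z] +
      (R.rho ![T x, T y] z + R.rho ![T y, T z] x + R.rho ![T z, T x] y) :=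
  add_comm _ _

theorem inducedRho_apply (u v : h) (x : g) :
    inducedRho R T ![u, v] x = A.bracket ![T u, T v, x] -
        T (R.rho ![x, T u] v + R.rho ![T v, x] u) := rfl

/-- The coboundary operator of the descendent 3-Lie algebra agrees, up to sign, with the differential
twisted by `T`; this identity of formulas holds for every linear map `T`. -/
theorem dT_eq_smul_l1Twisted [CharZero K] {m : ℕ} (f : Cochain K h g m) :
    (dT R lam T f : RawCochain h g (m + 1)) =
      (-1 : K) ^ m • l1Twisted R lam T (f : RawCochain h g m) := by
  obtain ⟨f, hf : IsCochain K f⟩ := f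
  funext X z
  have e1 := smul_proj_gradedBracket_incl (K := K) (semidirect R lam) f X z
  have e2 := smul_proj_gradedBracket_incl (K := K) (twice R lam T) f X z
  have z2a : ∀ a, R.rho ![0, a] = 0 := fun a => (alt2_linear_fst R.rho a).map_zero
  have z2b : ∀ a, R.rho ![a, 0] = 0 := fun a => (alt2_linear_snd R.rho a).map_zero
  have z3a : ∀ a b, A.bracket ![0, a, b] = 0 := fun a b => (alt3_linear_fst A.bracket a b).map_zero
  have z3b : ∀ a b, A.bracket ![a, 0, b] = 0 := fun a b => (alt3_linear_snd A.bracket a b).map_zero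
  have half : ∀ x : g, (1 / 2 : K) • (2 : K) • x = x := fun x => by
    rw [smul_smul]; norm_num
  have hlast : ∀ (j : Fin (m + 1)) (a b : h), f (j.removeNth X) (a + b) =
      f (j.removeNth X) a + (1 / 2 : K) • f (j.removeNth X) ((2 : K) • b) := fun j a b => by
    rw [(hf.linear_last _).map_add, (hf.linear_last _).map_smul, half]
  -- The condition on `j` and `k` matters: if the updated slot were the omitted one, the value would
  -- not be additive in it.
  have hfst : ∀ (j k : Fin (m + 1)) (a b y : h), j < k →
      f (j.removeNth (update X k (a + b, y))) z = f (j.removeNth (update X k (a, y))) z +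
        (1 / 2 : K) • f (j.removeNth (update X k ((2 : K) • b, y))) z := fun j k a b y hjk => by
    obtain ⟨k, rfl⟩ := Fin.exists_succAbove_eq hjk.ne'
    simp only [Fin.removeNth_update_succAbove]
    rw [(hf.linear_fst _ _ _ _).map_add, (hf.linear_fst _ _ _ _).map_smul, half]
  have hsnd : ∀ (j k : Fin (m + 1)) (a b y : h), j < k →
      f (j.removeNth (update X k (y, a + b))) z = f (j.removeNth (update X k (y, a))) z +
        (1 / 2 : K) • f (j.removeNth (update X k (y, (2 : K) • b))) z := fun j k a b y hjk => by
    obtain ⟨k, rfl⟩ := Fin.exists_succAbove_eq hjk.ne'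
    simp only [Fin.removeNth_update_succAbove]
    rw [(hf.linear_snd _ _ _ _).map_add, (hf.linear_snd _ _ _ _).map_smul, half]
  -- Here `p`, `q` are the two groups coming from `Δ`, and `r`, `s`, `t`, `u` the four coming from
  -- `½[[Δ, T], T]`.
  have reorder : ∀ p q r s t u : g,
      p + r + (q + s) + t + u = p + q + (r + s + t + u) := fun p q r s t u => by abel
  -- The triple bracket in `l3` is by definition the bracket of `twice` with `f`; the transports
  -- between equal degrees disappear definitionally.
  have e : (-1 : K) ^ m • l1Twisted R lam T f X z =
      (-1 : K) ^ m • (proj (gradedBracket (semidirect R lam) (incl f))).cast (Nat.add_comm 1 m) X z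
        + (1 / 2 : K) • (-1 : K) ^ m •
          (proj (gradedBracket (twice R lam T) (incl f))).cast (Nat.add_comm 1 m) X z := by
    rw [smul_comm (1 / 2 : K), ← smul_add]
    rfl
  refine Eq.trans ?_ e.symm
  rw [e1, e2]
  -- The last two groups for `Δ` vanish here: their `g`-parts are brackets with two zero entries.
  simp only [semidirect_apply, twice_apply, z2a, z2b, z3a, z3b, map_zero, LinearMap.zero_apply,
    add_zero, zero_add, smul_zero, Finset.sum_const_zero]
  change coboundaryFun _ _ _ _ _ = _
  simp only [coboundaryFun, descendentBracket_apply, smul_add (1 / 2 : K)]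
  refine Eq.trans ?_ (reorder _ _ _ _ _ _)
  congr 1
  · congr 1
    · congr 1
      · simp only [Finset.smul_sum, ← Finset.sum_add_distrib]
        refine Finset.sum_congr rfl fun j _ => Finset.sum_congr rfl fun k _ => ?_
        split_ifs with hjk
        · rw [hfst j k _ _ _ hjk, hsnd j k _ _ _ hjk, add_add_add_comm, smul_add, ← smul_add,
            smul_comm (1 / 2 : K)]
          simp
        · simp
      · simp only [Finset.smul_sum, ← Finset.sum_add_distrib]
        refine Finset.sum_congr rfl fun j _ => ?_
        rw [hlast, smul_add, smul_comm (1 / 2 : K)]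
    · rw [Finset.smul_sum]
      refine Finset.sum_congr rfl fun j _ => ?_
      rw [inducedRho_apply, smul_comm (1 / 2 : K), half, add_comm (R.rho _ _)]
  · rw [smul_comm (1 / 2 : K)]
    congr 1
    rw [inducedRho_apply, inducedRho_apply, smul_add, half, half]
    -- In `ϱ` the value of `f` sits in the third slot of the bracket, in the double bracket in the
    -- slot where it was inserted; cyclic rotations, being even, match the two.
    rw [alt3_rotate A.bracket (T (X (Fin.last m)).2),
      ← alt3_rotate A.bracket (T (X (Fin.last m)).1), add_comm (R.rho ![T (X (Fin.last m)).1, _] _)]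

end

end ThreeLie

theorem mainTheorem5 {K g h : Type*} [Field K] [CharZero K]
    [AddCommGroup g] [Module K g] [AddCommGroup h] [Module K h]
    (A : ThreeLie.ThreeLieAlgebra K g) (B : ThreeLie.ThreeLieAlgebra K h)
    (R : ThreeLie.Action A B) (lam : K) (T : h →ₗ[K] g)
    (hT : ThreeLie.IsRelativeRotaBaxter R lam T)
    (m : ℕ) (f : ThreeLie.Cochain K h g m) :
    (ThreeLie.dT R lam T f : ThreeLie.RawCochain h g (m + 1)) =
      (-1 : K) ^ m • ThreeLie.l1Twisted R lam T (f : ThreeLie.RawCochain h g m) :=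
  ThreeLie.dT_eq_smul_l1Twisted R lam T f
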